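/- Let $k$ be a field of characteristic zero. For an integer $n\ge 0$ let $R_n=k[x_0,\dots,x_n]$, let $D_n=x_0\frac{\partial}{\partial x_1}+\dots+x_{n-1}\frac{\partial}{\partial x_n}$ be the Weitzenböck derivation on $R_n$, and let $A_n=\ker D_n$. Let $I_n=A_{n,+}R_n$ be the Hilbert ideal, i.e. the ideal of $R_n$ generated by all homogeneous elements of $A_n$ of positive degree. For integers $0\le m<n$ let $\pi_{m,n}\colon R_n\to R_m$ be the $k$-algebra homomorphism $f(x_0,\dots,x_n)\mapsto f(\underbrace{0,\dots,0}_{n-m},x_0,\dots,x_m)$. Write $[n/2]$ for the largest integer $\le n/2$. Then: (a) $\sqrt{I_n}=(x_0,\dots,x_{[n/2]})R_n$ for all $n\ge 0$. (b) $\pi_{n-[n/2]-1,\,n}(A_n)=k$ for all $n\ge 1$. (c) $\pi_{m,2m}(A_{2m})=k[x_0^2]$ for all odd $m\ge 1$. (d) $\pi_{m,2m}(A_{2m})=k[x_0^2,x_0^3]$ for all even $m\ge 2$. -/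

import Mathlib

namespace BasicGa

/-- The polynomial ring `R_n = k[x_0, …, x_n]` in `n + 1` variables. -/
abbrev R (k : Type*) [Field k] (n : ℕ) : Type _ := MvPolynomial (Fin (n + 1)) k

/-- The Weitzenböck derivation `D_n = x_0 ∂/∂x_1 + … + x_{n-1} ∂/∂x_n` on `R_n`. -/
noncomputable def weitzenboeck (k : Type*) [Field k] (n : ℕ) :
    Derivation k (R k n) (R k n) :=
  ∑ i : Fin n, (MvPolynomial.X i.castSucc : R k n) • MvPolynomial.pderiv i.succ

/-- The algebra of invariants `A_n = ker D_n`, as a subalgebra of `R_n`. -/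
noncomputable def A (k : Type*) [Field k] (n : ℕ) : Subalgebra k (R k n) where
  carrier := {f | weitzenboeck k n f = 0}
  mul_mem' := by
    intro a b ha hb
    simp only [Set.mem_ofPred_eq] at ha hb ⊢
    rw [Derivation.leibniz, ha, hb, smul_zero, smul_zero, add_zero]
  add_mem' := by
    intro a b ha hb
    simp only [Set.mem_ofPred_eq] at ha hb ⊢
    rw [map_add, ha, hb, add_zero]
  algebraMap_mem' := fun c => (weitzenboeck k n).map_algebraMap c

/-- The Hilbert ideal `I_n = A_{n,+} R_n`: the ideal of `R_n` generated by all homogeneous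
invariants of positive degree. -/
noncomputable def hilbertIdeal (k : Type*) [Field k] (n : ℕ) : Ideal (R k n) :=
  Ideal.span {f | f ∈ A k n ∧ ∃ d : ℕ, 0 < d ∧ f.IsHomogeneous d}

/-- For `m < n`, the `k`-algebra homomorphism `π_{m,n} : R_n → R_m`,
`f(x_0, …, x_n) ↦ f(0, …, 0, x_0, …, x_m)` with `n - m` zeros: the variable `x_i` goes to `0`
if `i < n - m` and to `x_{i - (n - m)}` otherwise. -/
noncomputable def π (k : Type*) [Field k] (m n : ℕ) : R k n →ₐ[k] R k m :=
  MvPolynomial.aeval fun i : Fin (n + 1) =>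
    if (i : ℕ) < n - m then 0
    else MvPolynomial.X (⟨(i : ℕ) - (n - m), by have := i.isLt; omega⟩ : Fin (m + 1))

end BasicGa

/-! The derivation `weitzenboeck` is the raising operator of an `sl₂`-triple in which `x_i` has
weight `n - 2i`. Its kernel is spanned by highest weight vectors, and in characteristic zero these
have nonnegative weight; so every monomial of an invariant has nonnegative weight
(`weight_nonneg_of_coeff_ne_zero`).

A nonconstant monomial of an invariant therefore contains some `x_i` with `2i ≤ n`, which bounds the
Hilbert ideal from above and leaves only constants in (b). Conversely, the invariant `∑ (-1)^j x_j
x_{2i-j}` is `± x_i ^ 2` modulo `x_0, …, x_{i-1}`, so induction on `i` puts each such `x_i` in the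
radical.

For `n = 2m` the only monomials surviving `π` are the powers `x_m ^ d`, of weight zero. The quadric
gives `x_0 ^ 2`. For `m` odd, a weight-zero invariant is `SL₂`-invariant, and the Weyl element sends
the form `z ^ m` to `-z ^ m`, which excludes odd `d` (`coeff_middle_eq_zero_of_odd`). For `m` even,
`d = 1` is excluded directly, and a cubic invariant with nonzero `x_m ^ 3` coefficient is the umbral
image of `((u-v)(v-w)(w-u)) ^ m`. The coefficient of `(uvw) ^ m` there is, up to sign, a sum of
squares (`coeff_vandermonde_pow_ne_zero`). -/

namespace BasicGa

open MvPolynomial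

/-! ### Derivations and weighted gradings -/

section Grading

variable {k σ M : Type*} [CommRing k] [AddCancelCommMonoid M]

/-- A derivation shifting the weight of every variable by `c` shifts all weights by `c`. -/
theorem isWeightedHomogeneous_derivation {w : σ → M} {c : M}
    {d : Derivation k (MvPolynomial σ k) (MvPolynomial σ k)}
    (hd : ∀ i, (d (X i)).IsWeightedHomogeneous w (w i + c))
    {p : MvPolynomial σ k} {s : M} (hp : p.IsWeightedHomogeneous w s) :
    (d p).IsWeightedHomogeneous w (s + c) := by
  classical
  have hd' : d = mkDerivation k fun i => d (X i) := derivation_ext fun i => by simp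
  rw [p.as_sum, map_sum]
  refine (weightedHomogeneousSubmodule k w (s + c)).sum_mem fun α hα => ?_
  have hα' : Finsupp.weight w α = s := hp (mem_support_iff.mp hα)
  rw [hd', mkDerivation_monomial]
  refine Submodule.smul_mem _ _ ((weightedHomogeneousSubmodule k w (s + c)).sum_mem fun i hi => ?_)
  obtain ⟨β, rfl⟩ : ∃ β, α = β + Finsupp.single i 1 := by
    refine ⟨α - Finsupp.single i 1, (tsub_add_cancel_of_le ?_).symm⟩
    rw [Finsupp.single_le_iff]
    exact Nat.one_le_iff_ne_zero.mpr (Finsupp.mem_support_iff.mp hi)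
  beta_reduce
  rw [add_tsub_cancel_right, smul_eq_mul]
  rw [← hα', map_add, Finsupp.weight_single, one_smul, add_assoc]
  exact (isWeightedHomogeneous_monomial w β _ rfl).mul (hd i)

theorem weightedHomogeneousComponent_derivation {w : σ → M} {c : M}
    {d : Derivation k (MvPolynomial σ k) (MvPolynomial σ k)}
    (hd : ∀ i, (d (X i)).IsWeightedHomogeneous w (w i + c)) (p : MvPolynomial σ k) (s : M) :
    d (weightedHomogeneousComponent w s p) = weightedHomogeneousComponent w (s + c) (d p) := by
  classical
  induction p using MvPolynomial.induction_on' with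
  | monomial α a =>
    have h1 := isWeightedHomogeneous_monomial w α a rfl
    rw [weightedHomogeneousComponent_of_mem h1,
      weightedHomogeneousComponent_of_mem (isWeightedHomogeneous_derivation hd h1)]
    simp only [add_left_inj]
    split_ifs <;> simp
  | add p q hp hq => simp [hp, hq]

/-- Euler's identity for a diagonal derivation. -/
theorem derivation_eq_smul_of_isWeightedHomogeneous {w : σ → M}
    {d : Derivation k (MvPolynomial σ k) (MvPolynomial σ k)} (c : M →+ k)
    (hd : ∀ i, d (X i) = C (c (w i)) * X i)
    {p : MvPolynomial σ k} {s : M} (hp : p.IsWeightedHomogeneous w s) :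
    d p = C (c s) * p := by
  classical
  have hd' : d = mkDerivation k fun i => d (X i) := derivation_ext fun i => by simp
  conv_lhs => rw [p.as_sum]
  conv_rhs => rw [p.as_sum]
  rw [map_sum, Finset.mul_sum]
  refine Finset.sum_congr rfl fun α hα => ?_
  have hα' : Finsupp.weight w α = s := hp (mem_support_iff.mp hα)
  rw [← hα', hd', mkDerivation_monomial, Finsupp.weight_apply,
    Finsupp.sum, Finsupp.sum, map_sum, map_sum, Finset.sum_mul, Finset.smul_sum]
  refine Finset.sum_congr rfl fun i hi => ?_
  have hle : Finsupp.single i 1 ≤ α := by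
    rw [Finsupp.single_le_iff]
    exact Nat.one_le_iff_ne_zero.mpr (Finsupp.mem_support_iff.mp hi)
  rw [hd, smul_eq_mul, map_nsmul, mul_left_comm, X, monomial_mul, tsub_add_cancel_of_le hle,
    C_mul_monomial, C_mul_monomial, nsmul_eq_mul, smul_monomial, smul_eq_mul]
  congr 1
  ring

end Grading

theorem derivation_C_mul_apply {k σ : Type*} [CommRing k]
    (d : Derivation k (MvPolynomial σ k) (MvPolynomial σ k)) (a : k) (p : MvPolynomial σ k) :
    d (C a * p) = C a * d p := by
  rw [← smul_eq_C_mul, Derivation.map_smul, smul_eq_C_mul]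

/-! ### The `sl₂`-triple and weights of invariants -/

section Sl2

variable (k : Type*) [Field k] (n : ℕ)

/-- The variables of `R k n` indexed by `ℕ`, with `x_j = 0` for `j > n`. -/
noncomputable def var (j : ℕ) : R k n := if h : j < n + 1 then X ⟨j, h⟩ else 0

variable {k n} in
theorem var_of_le {j : ℕ} (h : j ≤ n) : var k n j = X ⟨j, Nat.lt_succ_of_le h⟩ :=
  dif_pos (Nat.lt_succ_of_le h)

variable {k n} in
theorem var_of_lt {j : ℕ} (h : n < j) : var k n j = 0 := dif_neg (by omega)

theorem var_val (i : Fin (n + 1)) : var k n i = X i := dif_pos i.isLt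

theorem weitzenboeck_apply (f : R k n) :
    weitzenboeck k n f = ∑ i : Fin n, X i.castSucc * pderiv i.succ f := by
  have h := map_sum (Derivation.coeFnAddMonoidHom (R := k) (A := R k n) (M := R k n))
    (fun i : Fin n => (X i.castSucc : R k n) • pderiv i.succ) Finset.univ
  exact (congrFun h f).trans (by simp [Finset.sum_apply])

theorem weitzenboeck_X_zero : weitzenboeck k n (X 0) = 0 := by
  rw [weitzenboeck_apply]
  exact Finset.sum_eq_zero fun i _ => by
    rw [pderiv_X_of_ne (Fin.succ_ne_zero i).symm, mul_zero]

theorem weitzenboeck_X_succ (i : Fin n) :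
    weitzenboeck k n (X i.succ) = X i.castSucc := by
  simp [weitzenboeck_apply, pderiv_X, Pi.single_apply]

theorem weitzenboeck_var_zero : weitzenboeck k n (var k n 0) = 0 := by
  rw [var_of_le (Nat.zero_le n)]; exact weitzenboeck_X_zero k n

variable {n} in
theorem weitzenboeck_var_succ {j : ℕ} (h : j < n) :
    weitzenboeck k n (var k n (j + 1)) = var k n j := by
  rw [var_of_le h, var_of_le h.le]
  exact weitzenboeck_X_succ k n ⟨j, h⟩

/-- The lowering operator completing the Weitzenböck derivation to an `sl₂`-triple. -/
noncomputable def lowering : Derivation k (R k n) (R k n) :=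
  mkDerivation k fun i => C (((i + 1) * (n - i : ℕ) : ℕ) : k) * var k n (i + 1)

variable {n} in
theorem lowering_var {j : ℕ} (h : j ≤ n) :
    lowering k n (var k n j) = C (((j + 1) * (n - j : ℕ) : ℕ) : k) * var k n (j + 1) := by
  rw [var_of_le h, lowering, mkDerivation_X]

/-- The bigrading of `R k n` by degree and by `sl₂`-weight. -/
def biweight (i : Fin (n + 1)) : ℕ × ℤ := (1, n - 2 * i)

theorem isWeightedHomogeneous_weitzenboeck_X (i : Fin (n + 1)) :
    (weitzenboeck k n (X i)).IsWeightedHomogeneous (biweight n) (biweight n i + (0, 2)) := by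
  induction i using Fin.cases with
  | zero => rw [weitzenboeck_X_zero]; exact isWeightedHomogeneous_zero _ _ _
  | succ i =>
    rw [weitzenboeck_X_succ]
    convert isWeightedHomogeneous_X k (biweight n) i.castSucc using 1
    simp [biweight]
    ring

theorem isWeightedHomogeneous_lowering_X (i : Fin (n + 1)) :
    (lowering k n (X i)).IsWeightedHomogeneous (biweight n) (biweight n i + (0, -2)) := by
  rw [lowering, mkDerivation_X]
  refine IsWeightedHomogeneous.C_mul ?_ _
  by_cases h : (i : ℕ) + 1 ≤ n
  · rw [var_of_le h]
    convert isWeightedHomogeneous_X k (biweight n) _ using 1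
    simp [biweight]
    ring
  · rw [var_of_lt (by omega)]
    exact isWeightedHomogeneous_zero _ _ _

/-- The `sl₂` relation on generators: `(i+1)(n-i) - i(n+1-i) = n - 2i`. Euler's identity then
extends it to all bihomogeneous polynomials. -/
theorem commutator_X (i : Fin (n + 1)) :
    ⁅weitzenboeck k n, lowering k n⁆ (X i) =
      C (((Int.castAddHom k).comp (AddMonoidHom.snd ℕ ℤ)) (biweight n i)) * X i := by
  have hcast : ((Int.castAddHom k).comp (AddMonoidHom.snd ℕ ℤ)) (biweight n i)
      = (n : k) - 2 * (i : ℕ) := by simp [biweight]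
  rw [hcast, ← var_val k n i, Derivation.commutator_apply]
  obtain ⟨j, hj⟩ := i
  simp only
  have h1 : lowering k n (weitzenboeck k n (var k n j)) =
      C ((j * (n + 1 - j) : ℕ) : k) * var k n j := by
    rcases j with _ | j
    · simp [weitzenboeck_var_zero]
    · rw [weitzenboeck_var_succ k (by omega), lowering_var k (by omega)]
      congr 4; omega
  have h2 : weitzenboeck k n (lowering k n (var k n j)) =
      C (((j + 1) * (n - j) : ℕ) : k) * var k n j := by
    rw [lowering_var k (by omega), derivation_C_mul_apply]
    by_cases h : j < n
    · rw [weitzenboeck_var_succ k h]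
    · have : n - j = 0 := by omega
      simp [this]
  rw [h1, h2, ← sub_mul, ← C_sub]
  congr 2
  rw [Nat.cast_mul, Nat.cast_mul, Nat.cast_sub (by omega), Nat.cast_sub (by omega)]
  push_cast
  ring

variable {k n}

theorem isWeightedHomogeneous_lowering_iterate {f : R k n} {d : ℕ} {s : ℤ}
    (hf : f.IsWeightedHomogeneous (biweight n) (d, s)) (j : ℕ) :
    ((lowering k n)^[j] f).IsWeightedHomogeneous (biweight n) (d, s - 2 * j) := by
  induction j with
  | zero => simpa using hf
  | succ j ih =>
    rw [Function.iterate_succ_apply']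
    have h : ((d, s - 2 * ((j + 1 : ℕ) : ℤ)) : ℕ × ℤ) = (d, s - 2 * j) + (0, -2) := by
      ext
      · simp
      · push_cast [Prod.snd_add]
        ring
    rw [h]
    exact isWeightedHomogeneous_derivation (isWeightedHomogeneous_lowering_X k n) ih

theorem weitzenboeck_lowering {f : R k n} {d : ℕ} {s : ℤ}
    (hf : f.IsWeightedHomogeneous (biweight n) (d, s)) :
    weitzenboeck k n (lowering k n f) = lowering k n (weitzenboeck k n f) + C (s : k) * f := by
  have h := derivation_eq_smul_of_isWeightedHomogeneous _ (commutator_X k n) hf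
  rw [Derivation.commutator_apply, sub_eq_iff_eq_add'] at h
  simpa using h

theorem weitzenboeck_lowering_iterate {f : R k n} {d : ℕ} {s : ℤ}
    (hf : f.IsWeightedHomogeneous (biweight n) (d, s)) (hD : weitzenboeck k n f = 0) (j : ℕ) :
    weitzenboeck k n ((lowering k n)^[j + 1] f) =
      C (((j + 1) * (s - j) : ℤ) : k) * (lowering k n)^[j] f := by
  induction j with
  | zero => simpa [hD] using weitzenboeck_lowering hf
  | succ j ih =>
    rw [Function.iterate_succ_apply',
      weitzenboeck_lowering (isWeightedHomogeneous_lowering_iterate hf (j + 1)), ih,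
      derivation_C_mul_apply, ← Function.iterate_succ_apply' (lowering k n), ← add_mul, ← C_add]
    congr 2
    push_cast
    ring

theorem weight_biweight (α : Fin (n + 1) →₀ ℕ) :
    Finsupp.weight (biweight n) α = (α.degree, ∑ i, (α i : ℤ) * (n - 2 * i)) := by
  rw [Finsupp.weight_apply, Finsupp.sum_fintype _ _ (by simp), Finsupp.degree_eq_sum]
  ext
  · simp [biweight, Prod.fst_sum]
  · simp [biweight, Prod.snd_sum]

/-- Each variable has weight at least `-n`. This makes the lowering operator nilpotent in each
degree. -/
theorem eq_zero_of_weight_lt {f : R k n} {d : ℕ} {s : ℤ}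
    (hf : f.IsWeightedHomogeneous (biweight n) (d, s)) (hs : s < -(n * d)) : f = 0 := by
  by_contra h
  obtain ⟨α, hα⟩ := ne_zero_iff.mp h
  have := hf hα
  rw [weight_biweight, Prod.mk.injEq, Finsupp.degree_eq_sum] at this
  obtain ⟨rfl, rfl⟩ := this
  refine absurd hs (not_lt.mpr ?_)
  push_cast
  rw [Finset.mul_sum, ← Finset.sum_neg_distrib]
  refine Finset.sum_le_sum fun i _ => ?_
  have : (i : ℤ) ≤ n := by have := i.isLt; omega
  nlinarith [Int.natCast_nonneg (α i)]

theorem weitzenboeck_component {f : R k n} (hf : f ∈ A k n) (s : ℕ × ℤ) :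
    weitzenboeck k n (weightedHomogeneousComponent (biweight n) s f) = 0 := by
  rw [weightedHomogeneousComponent_derivation (isWeightedHomogeneous_weitzenboeck_X k n),
    show weitzenboeck k n f = 0 from hf, map_zero]

variable [CharZero k]

/-- Highest weight vectors have nonnegative weight. -/
theorem eq_zero_of_weitzenboeck_eq_zero_of_weight_neg {f : R k n} {d : ℕ} {s : ℤ}
    (hf : f.IsWeightedHomogeneous (biweight n) (d, s)) (hD : weitzenboeck k n f = 0)
    (hs : s < 0) : f = 0 := by
  have key : ∀ j : ℕ, (lowering k n)^[j] f = 0 → f = 0 := by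
    intro j
    induction j with
    | zero => exact id
    | succ j ih =>
      intro h
      have h1 := weitzenboeck_lowering_iterate hf hD j
      rw [h, map_zero, eq_comm, mul_eq_zero, map_eq_zero, Int.cast_eq_zero, mul_eq_zero] at h1
      refine ih (h1.resolve_left ?_)
      omega
  -- After `n * d` lowerings the weight is `s - 2nd`, below the minimum `-nd` because `s < 0`. Going
  -- back up, the factors `(j+1)(s-j)` never vanish.
  refine key (n * d) (eq_zero_of_weight_lt (isWeightedHomogeneous_lowering_iterate hf _) ?_)
  push_cast
  nlinarith [Int.natCast_nonneg (n * d)]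

/-- The lowered vector has weight `-2` and is again killed by the raising operator, as the factor
`(j+1)(s-j)` is zero at `j = s = 0`. -/
theorem lowering_eq_zero_of_weight_zero {f : R k n} {d : ℕ}
    (hf : f.IsWeightedHomogeneous (biweight n) (d, 0)) (hD : weitzenboeck k n f = 0) :
    lowering k n f = 0 := by
  have h := isWeightedHomogeneous_lowering_iterate hf 1
  refine eq_zero_of_weitzenboeck_eq_zero_of_weight_neg h ?_ (by norm_num)
  exact (weitzenboeck_lowering_iterate hf hD 0).trans (by simp)

theorem weight_nonneg_of_coeff_ne_zero {f : R k n} (hf : f ∈ A k n) {α : Fin (n + 1) →₀ ℕ}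
    (hα : coeff α f ≠ 0) : 0 ≤ ∑ i, (α i : ℤ) * (n - 2 * i) := by
  classical
  by_contra! h
  have h0 := eq_zero_of_weitzenboeck_eq_zero_of_weight_neg
    (weightedHomogeneousComponent_isWeightedHomogeneous (w := biweight n) _ f)
    (weitzenboeck_component hf (α.degree, _)) h
  have := congrArg (coeff α) h0
  rw [coeff_weightedHomogeneousComponent, if_pos (weight_biweight α)] at this
  exact hα this

end Sl2

/-! ### The radical of the Hilbert ideal, and part (b) -/

section

/-- Setting the variables in `s` to zero maps to a domain and changes a polynomial only by an
element of the ideal; so nilpotents modulo the ideal vanish. -/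
theorem radical_span_X_image {k σ : Type*} [Field k] (s : Set σ) :
    (Ideal.span ((X : σ → MvPolynomial σ k) '' s)).radical = Ideal.span (X '' s) := by
  classical
  set J := Ideal.span ((X : σ → MvPolynomial σ k) '' s)
  let φ : MvPolynomial σ k →ₐ[k] MvPolynomial σ k := aeval fun i => if i ∈ s then 0 else X i
  have hJ : ∀ p ∈ J, φ p = 0 := by
    have : J ≤ RingHom.ker φ := Ideal.span_le.mpr (by
      rintro _ ⟨i, hi, rfl⟩
      simp [φ, hi])
    exact this
  have hφ : ∀ p, p - φ p ∈ J := by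
    have hcomp : (Ideal.Quotient.mkₐ k J).comp φ = Ideal.Quotient.mkₐ k J := by
      ext i
      by_cases hi : i ∈ s
      · have : X i ∈ J := Ideal.subset_span ⟨i, hi, rfl⟩
        simpa [φ, hi, eq_comm] using Ideal.Quotient.eq_zero_iff_mem.mpr this
      · simp [φ, hi]
    intro p
    rw [← Ideal.Quotient.eq]
    exact (DFunLike.congr_fun hcomp p).symm
  refine le_antisymm (fun p hp => ?_) Ideal.le_radical
  obtain ⟨r, hr⟩ := hp
  have h0 := hJ _ hr
  rw [map_pow] at h0
  have := hφ p
  rwa [eq_zero_of_pow_eq_zero h0, sub_zero] at this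

variable (k : Type*) [Field k] (n : ℕ)

/-- The quadratic form `∑ (-1)^j x_j x_{N-j}`. -/
noncomputable def alternatingQuadric (N : ℕ) : R k n :=
  ∑ j ∈ Finset.range (N + 1), C ((-1) ^ j) * (var k n j * var k n (N - j))

variable {n} in
theorem alternatingQuadric_mem {N : ℕ} (h : N ≤ n) : alternatingQuadric k n N ∈ A k n := by
  change weitzenboeck k n _ = 0
  have h1 : ∀ j, weitzenboeck k n (C ((-1) ^ j) * (var k n j * var k n (N - j))) =
      C ((-1) ^ j) * (var k n (N - j) * weitzenboeck k n (var k n j)) +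
      C ((-1) ^ j) * (var k n j * weitzenboeck k n (var k n (N - j))) := by
    intro j
    rw [derivation_C_mul_apply, Derivation.leibniz, smul_eq_mul, smul_eq_mul]
    ring
  rw [alternatingQuadric, map_sum]
  simp_rw [h1]
  -- The two halves of the Leibniz rule cancel after an index shift; the unpaired end terms both
  -- contain the derivative of `x_0`.
  rw [Finset.sum_add_distrib, Finset.sum_range_succ', Finset.sum_range_succ (n := N),
    weitzenboeck_var_zero, Nat.sub_self, weitzenboeck_var_zero, mul_zero, mul_zero, mul_zero,
    mul_zero, add_zero, add_zero, ← Finset.sum_add_distrib]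
  refine Finset.sum_eq_zero fun j hj => ?_
  rw [Finset.mem_range] at hj
  obtain ⟨l, rfl⟩ : ∃ l, N = j + l + 1 := ⟨N - j - 1, by omega⟩
  rw [show j + l + 1 - (j + 1) = l by omega, show j + l + 1 - j = l + 1 by omega,
    weitzenboeck_var_succ k (by omega), weitzenboeck_var_succ k (by omega), pow_succ]
  simp
  ring

theorem isHomogeneous_var (j : ℕ) : (var k n j).IsHomogeneous 1 := by
  rw [var]
  split_ifs
  · exact isHomogeneous_X _ _
  · exact isHomogeneous_zero _ _ _

theorem isHomogeneous_alternatingQuadric (N : ℕ) : (alternatingQuadric k n N).IsHomogeneous 2 :=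
  IsHomogeneous.sum _ _ _ fun _ _ =>
    ((isHomogeneous_var k n _).mul (isHomogeneous_var k n _)).C_mul _

theorem var_mem_radical_hilbertIdeal {i : ℕ} (h : 2 * i ≤ n) :
    var k n i ∈ (hilbertIdeal k n).radical := by
  induction i using Nat.strong_induction_on with
  | _ i ih =>
    have h1 : alternatingQuadric k n (2 * i) ∈ (hilbertIdeal k n).radical :=
      Ideal.le_radical (Ideal.subset_span ⟨alternatingQuadric_mem k h, 2, two_pos,
        isHomogeneous_alternatingQuadric k n _⟩)
    rw [alternatingQuadric, ← Finset.add_sum_erase _ _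
      (Finset.mem_range.mpr (show i < 2 * i + 1 by omega)), show 2 * i - i = i by omega] at h1
    rw [Ideal.add_mem_iff_left] at h1
    · refine (Ideal.radical_isRadical _) ⟨2, ?_⟩
      have h2 := Ideal.mul_mem_left _ (C ((-1) ^ i)) h1
      rwa [← mul_assoc, ← C_mul, ← mul_pow, neg_one_mul, neg_neg, one_pow, C_1, one_mul,
        ← pow_two] at h2
    · refine Ideal.sum_mem _ fun j hj => Ideal.mul_mem_left _ _ ?_
      rw [Finset.mem_erase, Finset.mem_range] at hj
      rcases lt_or_gt_of_ne hj.1 with hlt | hgt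
      · exact Ideal.mul_mem_right _ _ (ih j hlt (by omega))
      · exact Ideal.mul_mem_left _ _ (ih _ (by omega) (by omega))

variable {k n}

/-- All summands are nonpositive, so a nonnegative sum forces each one to vanish. -/
theorem two_mul_eq_of_sum_nonneg {α : Fin (n + 1) →₀ ℕ}
    (hα : 0 ≤ ∑ i, (α i : ℤ) * (n - 2 * i)) (h : ∀ i, α i ≠ 0 → n ≤ 2 * (i : ℕ))
    {i : Fin (n + 1)} (hi : α i ≠ 0) : n = 2 * (i : ℕ) := by
  have hle : ∀ j ∈ Finset.univ, (α j : ℤ) * (n - 2 * j) ≤ 0 := by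
    intro j _
    by_cases hj : α j = 0
    · simp [hj]
    · have := h j hj
      exact mul_nonpos_of_nonneg_of_nonpos (by positivity) (by omega)
  have := (Finset.sum_eq_zero_iff_of_nonpos hle).mp (le_antisymm (Finset.sum_nonpos hle) hα) i
    (Finset.mem_univ i)
  rw [mul_eq_zero, Int.natCast_eq_zero] at this
  have := this.resolve_left hi
  omega

theorem π_mem_of_monomials {m : ℕ} {f : R k n} (B : Subalgebra k (R k m))
    (h : ∀ α ∈ f.support, (∀ i, α i ≠ 0 → n - m ≤ (i : ℕ)) →
      π k m n (monomial α (coeff α f)) ∈ B) : π k m n f ∈ B := by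
  rw [f.as_sum, map_sum]
  refine Subalgebra.sum_mem _ fun α hα => ?_
  by_cases hi : ∀ i, α i ≠ 0 → n - m ≤ (i : ℕ)
  · exact h α hα hi
  · push Not at hi
    obtain ⟨i, hi, hlt⟩ := hi
    convert B.zero_mem
    rw [π, aeval_monomial, Finsupp.prod,
      Finset.prod_eq_zero (Finsupp.mem_support_iff.mpr hi) (by simp [hlt, hi]), mul_zero]

variable [CharZero k]

theorem radical_hilbertIdeal : (hilbertIdeal k n).radical =
    Ideal.span ((fun i : Fin (n + 1) => (X i : R k n)) '' {i | (i : ℕ) ≤ n / 2}) := by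
  refine le_antisymm ?_ (Ideal.span_le.mpr ?_)
  · refine le_trans (Ideal.radical_mono (Ideal.span_le.mpr ?_))
      (radical_span_X_image {i : Fin (n + 1) | (i : ℕ) ≤ n / 2}).le
    rintro f ⟨hf, d, hd, hfd⟩
    refine mem_ideal_span_X_image.mpr fun α hα => ?_
    have hα := mem_support_iff.mp hα
    by_contra! h
    have hd' := hfd hα
    obtain ⟨i, hi⟩ : ∃ i, α i ≠ 0 := by
      by_contra! h0
      rw [show α = 0 from Finsupp.ext h0, map_zero] at hd'
      omega
    have hlt : ∀ i, α i ≠ 0 → n < 2 * (i : ℕ) := by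
      intro j hj
      have := mt (h j) hj
      simp only [Set.mem_ofPred_eq] at this
      omega
    have := two_mul_eq_of_sum_nonneg (weight_nonneg_of_coeff_ne_zero hf hα)
      (fun j hj => (hlt j hj).le) hi
    have := hlt i hi
    omega
  · rintro _ ⟨i, hi, rfl⟩
    have hi : (i : ℕ) ≤ n / 2 := hi
    have := var_mem_radical_hilbertIdeal k n (i := i) (by omega)
    rwa [var_val] at this

theorem map_π_eq_bot (hn : 1 ≤ n) : (A k n).map (π k (n - n / 2 - 1) n) = ⊥ := by
  refine le_antisymm ?_ bot_le
  rintro _ ⟨f, hf, rfl⟩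
  refine π_mem_of_monomials ⊥ fun α hα h => ?_
  have h0 : α = 0 := by
    ext i
    by_contra hi
    have hlt : ∀ i, α i ≠ 0 → n < 2 * (i : ℕ) := fun j hj => by have := h j hj; omega
    have := two_mul_eq_of_sum_nonneg (weight_nonneg_of_coeff_ne_zero hf (mem_support_iff.mp hα))
      (fun j hj => (hlt j hj).le) hi
    have := hlt i hi
    omega
  rw [h0, ← C_apply, ← algebraMap_eq, AlgHom.commutes]
  exact Subalgebra.algebraMap_mem _ _

end

/-! ### Evaluation at binary forms and `SL₂`-invariance -/

section

variable {k : Type*} [Field k] {n : ℕ}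

variable (n) in
/-- Evaluation of `R k n` at the binary form with dehomogenization `q`, in coordinates for which
the flow of the Weitzenböck derivation is translation. -/
noncomputable def evalForm (q : Polynomial k) : R k n →ₐ[k] k :=
  aeval fun i => ((n - i : ℕ).factorial : k) * q.coeff (n - i)

variable (n) in
/-- The restriction of `R k n` to the orbit of `q` under translations. -/
noncomputable def evalOrbit (q : Polynomial k) : R k n →ₐ[k] Polynomial k :=
  aeval fun i => Polynomial.derivative^[n - i] q

theorem eval_evalOrbit (q : Polynomial k) (t : k) (f : R k n) :
    (evalOrbit n q f).eval t = evalForm n (Polynomial.taylor t q) f := by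
  have : (Polynomial.aeval t).comp (evalOrbit n q) = evalForm n (Polynomial.taylor t q) := by
    ext i
    simp only [evalOrbit, evalForm, AlgHom.comp_apply, aeval_X, Polynomial.taylor_coeff,
      Polynomial.coe_aeval_eq_eval, ← Polynomial.factorial_smul_hasseDeriv]
    simp
  simpa using DFunLike.congr_fun this f

theorem derivative_evalOrbit {q : Polynomial k} (hq : q.natDegree ≤ n) (f : R k n) :
    Polynomial.derivative (evalOrbit n q f) = evalOrbit n q (weitzenboeck k n f) := by
  induction f using MvPolynomial.induction_on with
  | C a => rw [← algebraMap_eq, AlgHom.commutes, Derivation.map_algebraMap]; simp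
  | add p q hp hq => simp [hp, hq]
  | mul_X p i hp =>
    have hX : Polynomial.derivative (evalOrbit n q (X i)) =
        evalOrbit n q (weitzenboeck k n (X i)) := by
      induction i using Fin.cases with
      | zero =>
        rw [weitzenboeck_X_zero, map_zero, evalOrbit, aeval_X,
          ← Function.iterate_succ_apply' Polynomial.derivative]
        exact Polynomial.iterate_derivative_eq_zero (by simp; omega)
      | succ i =>
        rw [weitzenboeck_X_succ, evalOrbit, aeval_X, aeval_X,
          ← Function.iterate_succ_apply' Polynomial.derivative]
        congr 2
        simp
        omega
    rw [map_mul, Polynomial.derivative_mul, hp, hX, Derivation.leibniz, map_add, smul_eq_mul,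
      smul_eq_mul, map_mul, map_mul]
    ring

/-- Along the translation orbit of `q`, an invariant has zero derivative, hence is constant in
characteristic zero. -/
theorem evalForm_taylor [CharZero k] {f : R k n} (hf : weitzenboeck k n f = 0)
    {q : Polynomial k} (hq : q.natDegree ≤ n) (t : k) :
    evalForm n (Polynomial.taylor t q) f = evalForm n q f := by
  have h := derivative_evalOrbit hq f
  rw [hf, map_zero] at h
  have h1 := eval_evalOrbit q t f
  have h0 := eval_evalOrbit q 0 f
  rw [Polynomial.eq_C_of_derivative_eq_zero h, Polynomial.eval_C] at h0 h1
  rw [← h1, h0, Polynomial.taylor_zero]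

variable (k n) in
/-- The Weyl involution, up to scaling of the variables. -/
noncomputable def reversal : R k n →ₐ[k] R k n :=
  aeval fun i => C (((n - i : ℕ).factorial : k) / ((i : ℕ).factorial : k)) * var k n (n - i)

theorem reversal_var {j : ℕ} (h : j ≤ n) : reversal k n (var k n j) =
    C (((n - j : ℕ).factorial : k) / (j.factorial : k)) * var k n (n - j) := by
  rw [var_of_le h, reversal, aeval_X]

theorem evalForm_var {q : Polynomial k} {j : ℕ} (h : j ≤ n) :
    evalForm n q (var k n j) = ((n - j : ℕ).factorial : k) * q.coeff (n - j) := by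
  rw [var_of_le h, evalForm, aeval_X]

theorem reflect_pow {q : Polynomial k} {N : ℕ} (hq : q.natDegree ≤ N) (m : ℕ) :
    (q ^ m).reflect (N * m) = q.reflect N ^ m := by
  induction m with
  | zero => simp
  | succ m ih =>
    rw [pow_succ, Nat.mul_succ, Polynomial.reflect_mul _ _ ?_ hq, ih, pow_succ]
    exact Polynomial.natDegree_pow_le.trans (by rw [mul_comm]; exact Nat.mul_le_mul_right _ hq)

theorem eq_single_of_forall_ne_zero {σ : Type*} {α : σ →₀ ℕ} {a : σ}
    (h : ∀ i, α i ≠ 0 → i = a) : α = Finsupp.single a (α a) := by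
  ext i
  by_cases hia : i = a
  · rw [hia, Finsupp.single_eq_same]
  · rw [Finsupp.single_eq_of_ne hia]
    exact not_imp_comm.mp (h i) hia

/-- At the form `c z ^ m` every coordinate except `x_m` vanishes, so evaluation reads off the
coefficient of `x_m ^ d`. -/
theorem evalForm_C_mul_X_pow {m d : ℕ} {f : R k (2 * m)} (hf : f.IsHomogeneous d) (c : k) :
    evalForm (2 * m) (Polynomial.C c * Polynomial.X ^ m) f =
      coeff (Finsupp.single ⟨m, by omega⟩ d) f * (m.factorial * c) ^ d := by
  rw [evalForm, aeval_def, eval₂_eq, Finset.sum_eq_single (Finsupp.single ⟨m, by omega⟩ d)]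
  · by_cases hd : d = 0
    · simp [hd]
    · rw [Finsupp.support_single _ hd, Finset.prod_singleton]
      simp [show 2 * m - m = m by omega]
  · intro α hα hne
    suffices h : ∃ i ∈ α.support, (i : ℕ) ≠ m by
      obtain ⟨i, hi, him⟩ := h
      rw [Finset.prod_eq_zero hi, mul_zero]
      have : 2 * m - i ≠ m := by have := i.isLt; omega
      simp [Polynomial.coeff_X_pow, this, Finsupp.mem_support_iff.mp hi]
    by_contra! h
    refine hne ?_
    have hs : α = Finsupp.single ⟨m, by omega⟩ (α ⟨m, by omega⟩) :=
      eq_single_of_forall_ne_zero fun i hi => Fin.ext (h i (Finsupp.mem_support_iff.mpr hi))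
    have hd := hf (mem_support_iff.mp hα)
    rw [hs, Finsupp.weight_single] at hd
    rw [hs, ← hd]
    simp
  · intro h
    rw [notMem_support_iff.mp h, map_zero, zero_mul]

theorem isHomogeneous_of_biweight {f : R k n} {s : ℕ × ℤ}
    (hf : f.IsWeightedHomogeneous (biweight n) s) : f.IsHomogeneous s.1 := by
  intro α hα
  have := hf hα
  rw [weight_biweight] at this
  rw [← this, Pi.one_def, ← Finsupp.degree_eq_weight_one]

theorem biweight_single_middle (m d : ℕ) :
    Finsupp.weight (biweight (2 * m)) (Finsupp.single ⟨m, by omega⟩ d) = (d, 0) := by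
  rw [Finsupp.weight_single]
  ext <;> simp [biweight]

theorem exists_eq_single_of_degree_eq_one {σ : Type*} {α : σ →₀ ℕ} (h : α.degree = 1) :
    ∃ i, α = Finsupp.single i 1 := by
  obtain ⟨i, hi⟩ : ∃ i, α i ≠ 0 := by
    by_contra! h0
    rw [show α = 0 from Finsupp.ext h0, map_zero] at h
    omega
  have hle : Finsupp.single i 1 ≤ α := Finsupp.single_le_iff.mpr (Nat.one_le_iff_ne_zero.mpr hi)
  refine ⟨i, ?_⟩
  rw [← tsub_add_cancel_of_le hle, map_add, Finsupp.degree_single, Nat.add_eq_right,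
    Finsupp.degree_eq_zero_iff] at h
  exact le_antisymm (tsub_eq_zero_iff_le.mp h) hle

/-- The component of degree one and weight zero is `c x_m`, whose derivative is `c x_{m-1}`. -/
theorem coeff_middle_one_eq_zero {m : ℕ} (hm : 1 ≤ m) {f : R k (2 * m)}
    (hf : f ∈ A k (2 * m)) : coeff (Finsupp.single ⟨m, by omega⟩ 1) f = 0 := by
  classical
  have hg := weightedHomogeneousComponent_isWeightedHomogeneous (w := biweight (2 * m)) (1, 0) f
  have hD := weitzenboeck_component hf (1, 0)
  have h1 := eq_monomial_of_support_subset_singleton (d₀ := Finsupp.single ⟨m, by omega⟩ 1)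
    (φ := weightedHomogeneousComponent (biweight (2 * m)) (1, 0) f) fun α hα => by
      have hw := hg (mem_support_iff.mp hα)
      have h1 : α.degree = 1 := by
        rw [weight_biweight] at hw
        exact congrArg Prod.fst hw
      obtain ⟨i, rfl⟩ := exists_eq_single_of_degree_eq_one h1
      rw [Finsupp.weight_single, one_smul, biweight, Prod.mk.injEq] at hw
      have hi : i = ⟨m, by omega⟩ := Fin.ext (by have := hw.2; push_cast at this; simp; omega)
      rw [hi]
  obtain ⟨l, rfl⟩ : ∃ l, m = l + 1 := ⟨m - 1, by omega⟩
  rw [h1, coeff_weightedHomogeneousComponent, biweight_single_middle, if_pos rfl] at hD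
  have h2 (c : k) : (monomial (Finsupp.single ⟨l + 1, by omega⟩ 1) c : R k (2 * (l + 1))) =
      C c * var k _ (l + 1) := by
    rw [var_of_le (by omega), C_mul_X_eq_monomial]
  rw [h2, derivation_C_mul_apply, weitzenboeck_var_succ k (by omega), var_of_le (by omega),
    mul_eq_zero, map_eq_zero] at hD
  exact hD.resolve_right (X_ne_zero _)

variable [CharZero k]

theorem evalForm_reversal (q : Polynomial k) (f : R k n) :
    evalForm n q (reversal k n f) = evalForm n (q.reflect n) f := by
  have : (evalForm n q).comp (reversal k n) = evalForm n (q.reflect n) := by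
    ext i
    have hi : (i : ℕ) ≤ n := Nat.lt_succ_iff.mp i.isLt
    rw [AlgHom.comp_apply, ← var_val, reversal_var hi, evalForm_var hi, map_mul,
      evalForm_var (by omega), Polynomial.coeff_reflect, Polynomial.revAt_le (by omega),
      ← algebraMap_eq, AlgHom.commutes, Nat.sub_sub_self hi]
    have := Nat.cast_ne_zero (R := k).mpr (Nat.factorial_ne_zero (i : ℕ))
    simp
    field_simp
  exact DFunLike.congr_fun this f

/-- Reversal intertwines lowering with raising, so invariance under the opposite unipotent group
reduces to `evalForm_taylor`. -/
theorem weitzenboeck_reversal (f : R k n) :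
    weitzenboeck k n (reversal k n f) = reversal k n (lowering k n f) := by
  induction f using MvPolynomial.induction_on with
  | C a =>
    rw [← algebraMap_eq, AlgHom.commutes, Derivation.map_algebraMap, Derivation.map_algebraMap,
      map_zero]
  | add p q hp hq => simp [hp, hq]
  | mul_X p i hp =>
    have hX : weitzenboeck k n (reversal k n (X i)) = reversal k n (lowering k n (X i)) := by
      have hi : (i : ℕ) ≤ n := Nat.lt_succ_iff.mp i.isLt
      rw [← var_val, reversal_var hi, lowering_var k hi, derivation_C_mul_apply, map_mul,
        ← algebraMap_eq, AlgHom.commutes]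
      rcases hi.eq_or_lt with h | h
      · simp [h, weitzenboeck_var_zero]
      · obtain ⟨l, hl⟩ : ∃ l, n = i + l + 1 := ⟨n - i - 1, by omega⟩
        rw [reversal_var h, show n - i = l + 1 by omega, weitzenboeck_var_succ k (by omega),
          show n - (i + 1) = l by omega, algebraMap_eq, ← mul_assoc, ← C_mul]
        congr 2
        have := Nat.cast_ne_zero (R := k).mpr (Nat.factorial_ne_zero (i : ℕ))
        have h2 : ((i : ℕ) : k) + 1 ≠ 0 := Nat.cast_add_one_ne_zero _
        rw [Nat.factorial_succ, Nat.factorial_succ]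
        push_cast
        field_simp
    rw [map_mul, Derivation.leibniz, Derivation.leibniz, hp, hX]
    simp

theorem evalForm_reflect_taylor {f : R k n} (hf : lowering k n f = 0)
    {q : Polynomial k} (hq : q.natDegree ≤ n) (t : k) :
    evalForm n ((Polynomial.taylor t q).reflect n) f = evalForm n (q.reflect n) f := by
  rw [← evalForm_reversal, ← evalForm_reversal]
  refine evalForm_taylor ?_ hq t
  rw [weitzenboeck_reversal, hf, map_zero]

/-- `SL₂`-invariants take the same value at `z ^ m` and at its image under the Weyl element. -/
theorem evalForm_neg_X_pow {m : ℕ} {f : R k (2 * m)} (hD : weitzenboeck k (2 * m) f = 0)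
    (hF : lowering k (2 * m) f = 0) :
    evalForm (2 * m) ((-Polynomial.X) ^ m) f = evalForm (2 * m) (Polynomial.X ^ m) f := by
  have hdeg : ∀ {q : Polynomial k}, q.natDegree ≤ 2 → (q ^ m).natDegree ≤ 2 * m := fun hq =>
    Polynomial.natDegree_pow_le.trans (by rw [mul_comm]; exact Nat.mul_le_mul_right _ hq)
  have hX (a : k) : (Polynomial.X + Polynomial.C a).natDegree ≤ 1 :=
    (Polynomial.natDegree_X_add_C a).le
  have hXX (a : k) : (Polynomial.X * (Polynomial.X + Polynomial.C a)).natDegree ≤ 2 :=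
    Polynomial.natDegree_mul_le_of_le Polynomial.natDegree_X_le (hX a)
  have hr (a : k) : (Polynomial.X * (Polynomial.X + Polynomial.C a)).reflect 2 =
      1 + Polynomial.C a * Polynomial.X := by
    rw [Polynomial.reflect_mul (F := 1) (G := 1) _ _ Polynomial.natDegree_X_le (hX a)]
    simp
  -- The Weyl element as a product of three unipotents. Read upwards: `z` translates to `z + 1`,
  -- reverses to `z(z+1)`, translates to `z(z-1)`, reverses to `1 - z`, and translates to `-z`, all
  -- raised to the power `m`.
  calc evalForm (2 * m) ((-Polynomial.X) ^ m) f
      = evalForm (2 * m) ((1 + Polynomial.C (-1) * Polynomial.X) ^ m) f := by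
        rw [← evalForm_taylor hD (hdeg (q := 1 + Polynomial.C (-1) * Polynomial.X) ?_) 1,
          Polynomial.taylor_pow]
        · congr 2
          simp
        · compute_degree!
    _ = evalForm (2 * m) (((Polynomial.X * (Polynomial.X + Polynomial.C (-1 : k))) ^ m).reflect
          (2 * m)) f := by rw [reflect_pow (hXX _), hr]
    _ = evalForm (2 * m) ((Polynomial.taylor (-1) ((Polynomial.X *
          (Polynomial.X + Polynomial.C (1 : k))) ^ m)).reflect (2 * m)) f := by
        congr 3
        rw [Polynomial.taylor_pow, Polynomial.taylor_mul]
        congr 1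
        simp
        ring
    _ = evalForm (2 * m) ((Polynomial.X + Polynomial.C (1 : k)) ^ m) f := by
        rw [evalForm_reflect_taylor hF (hdeg (hXX _)), reflect_pow (hXX _), hr]
        congr 2
        simp
        ring
    _ = evalForm (2 * m) (Polynomial.X ^ m) f := by
        rw [← Polynomial.taylor_X_pow, evalForm_taylor hD (hdeg (by simp))]

theorem coeff_middle_eq_zero_of_odd {m d : ℕ} (hm : Odd m) (hd : Odd d) {f : R k (2 * m)}
    (hf : f ∈ A k (2 * m)) : coeff (Finsupp.single ⟨m, by omega⟩ d) f = 0 := by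
  classical
  have hg := weightedHomogeneousComponent_isWeightedHomogeneous (w := biweight (2 * m)) (d, 0) f
  have hD := weitzenboeck_component hf (d, 0)
  have h := evalForm_neg_X_pow hD (lowering_eq_zero_of_weight_zero hg hD)
  have h1 := evalForm_C_mul_X_pow (isHomogeneous_of_biweight hg) (1 : k)
  have h2 := evalForm_C_mul_X_pow (isHomogeneous_of_biweight hg) (-1 : k)
  rw [Polynomial.C_1, one_mul] at h1
  rw [hm.neg_pow, ← neg_one_mul, ← Polynomial.C_1, ← Polynomial.C_neg, h1, h2] at h
  simp only [coeff_weightedHomogeneousComponent, biweight_single_middle, if_true] at h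
  rw [mul_neg, hd.neg_pow, mul_neg, neg_eq_iff_add_eq_zero, mul_one, ← two_mul] at h
  simpa [Nat.factorial_ne_zero] using h

end

/-! ### Palindromic polynomials -/

section Palindromic

variable {k σ : Type*} [CommRing k]

/-- `p` has support below `e`, and `X ^ e * p (X⁻¹) = ε * p`. -/
structure IsPalindromic (p : MvPolynomial σ k) (e : σ →₀ ℕ) (ε : k) : Prop where
  le : ∀ α, coeff α p ≠ 0 → α ≤ e
  coeff_eq : ∀ α β, α + β = e → coeff α p = ε * coeff β p

theorem IsPalindromic.mul {p q : MvPolynomial σ k} {e e' : σ →₀ ℕ} {ε ε' : k}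
    (hp : IsPalindromic p e ε) (hq : IsPalindromic q e' ε') :
    IsPalindromic (p * q) (e + e') (ε * ε') where
  le α hα := by
    classical
    rw [coeff_mul] at hα
    obtain ⟨x, hx, hne⟩ := Finset.exists_ne_zero_of_sum_ne_zero hα
    rw [← Finset.HasAntidiagonal.mem_antidiagonal.mp hx]
    exact add_le_add (hp.le _ (left_ne_zero_of_mul hne)) (hq.le _ (right_ne_zero_of_mul hne))
  coeff_eq α β h := by
    classical
    rw [coeff_mul, coeff_mul, Finset.mul_sum]
    have key : ∀ {α β : σ →₀ ℕ}, α + β = e + e' → ∀ x ∈ Finset.HasAntidiagonal.antidiagonal α,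
        x.1 ≤ e → x.2 ≤ e' → (e - x.1, e' - x.2) ∈ Finset.HasAntidiagonal.antidiagonal β := by
      intro α β h x hx h1 h2
      rw [Finset.HasAntidiagonal.mem_antidiagonal] at hx ⊢
      have := congrArg (· + x.1 + x.2) h
      refine add_left_cancel (a := α) ?_
      rw [h, ← hx]
      ext i
      have h1 := h1 i
      have h2 := h2 i
      simp
      omega
    -- Truncated subtraction is an involution only below `e` and `e'`, which is guaranteed just for
    -- the nonzero terms.
    refine Finset.sum_bij_ne_zero (fun x _ _ => (e - x.1, e' - x.2)) ?_ ?_ ?_ ?_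
    · intro x hx hne
      exact key h x hx (hp.le _ (left_ne_zero_of_mul hne)) (hq.le _ (right_ne_zero_of_mul hne))
    · intro x hx hne y hy hne' hxy
      rw [Prod.mk.injEq] at hxy
      refine Prod.ext ?_ ?_
      · exact tsub_injOn (hp.le _ (left_ne_zero_of_mul hne))
          (hp.le _ (left_ne_zero_of_mul hne')) hxy.1
      · exact tsub_injOn (hq.le _ (right_ne_zero_of_mul hne))
          (hq.le _ (right_ne_zero_of_mul hne')) hxy.2
    · intro y hy hne
      have hne' := right_ne_zero_of_mul hne
      have h1 := hp.le _ (left_ne_zero_of_mul hne')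
      have h2 := hq.le _ (right_ne_zero_of_mul hne')
      refine ⟨(e - y.1, e' - y.2), key ((add_comm _ _).trans h) y hy h1 h2, ?_, ?_⟩
      · rw [hp.coeff_eq _ y.1 (tsub_add_cancel_of_le h1),
          hq.coeff_eq _ y.2 (tsub_add_cancel_of_le h2)]
        convert hne using 1
        ring
      · simp [tsub_tsub_cancel_of_le h1, tsub_tsub_cancel_of_le h2]
    · intro x hx hne
      rw [hp.coeff_eq x.1 _ (add_tsub_cancel_of_le (hp.le _ (left_ne_zero_of_mul hne))),
        hq.coeff_eq x.2 _ (add_tsub_cancel_of_le (hq.le _ (right_ne_zero_of_mul hne)))]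
      ring
where
  tsub_injOn {a b c : σ →₀ ℕ} (h1 : a ≤ c) (h2 : b ≤ c) (h : c - a = c - b) : a = b := by
    rw [← tsub_tsub_cancel_of_le h1, h, tsub_tsub_cancel_of_le h2]

theorem IsPalindromic.one : IsPalindromic (1 : MvPolynomial σ k) 0 1 where
  le α hα := by
    classical
    rw [coeff_one] at hα
    by_contra h
    exact hα (if_neg fun h0 => h h0.symm.le)
  coeff_eq α β h := by
    rw [add_eq_zero] at h
    rw [h.1, h.2, one_mul]

theorem IsPalindromic.pow {p : MvPolynomial σ k} {e : σ →₀ ℕ} {ε : k}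
    (hp : IsPalindromic p e ε) (a : ℕ) : IsPalindromic (p ^ a) (a • e) (ε ^ a) := by
  induction a with
  | zero => simpa using IsPalindromic.one
  | succ a ih => rw [pow_succ, pow_succ, succ_nsmul]; exact ih.mul hp

theorem IsPalindromic.X_sub_X (i j : σ) :
    IsPalindromic (X i - X j : MvPolynomial σ k) (Finsupp.single i 1 + Finsupp.single j 1) (-1) where
  le α hα := by
    classical
    rw [coeff_sub, coeff_X, coeff_X] at hα
    split_ifs at hα with h1 h2 h2
    · simp at hα
    · rw [← h1]; exact le_self_add
    · rw [← h2]; exact le_add_self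
    · simp at hα
  coeff_eq α β h := by
    classical
    have h1 : Finsupp.single i 1 = α ↔ Finsupp.single j 1 = β := by
      constructor
      · rintro rfl; exact (add_left_cancel h).symm
      · rintro rfl; exact (add_right_cancel h).symm
    have h2 : Finsupp.single j 1 = α ↔ Finsupp.single i 1 = β := by
      rw [add_comm (Finsupp.single i 1)] at h
      constructor
      · rintro rfl; exact (add_left_cancel h).symm
      · rintro rfl; exact (add_right_cancel h).symm
    simp only [coeff_sub, coeff_X, h1, h2]
    ring

/-- Palindromicity pairs each coefficient with itself up to `ε`, so the coefficient is `ε` times a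
sum of integer squares, not all zero. -/
theorem IsPalindromic.coeff_mul_self_ne_zero {p : MvPolynomial σ ℤ} {e : σ →₀ ℕ} {ε : ℤ}
    (hp : IsPalindromic p e ε) (h0 : p ≠ 0) (hε : ε ≠ 0) : coeff e (p * p) ≠ 0 := by
  classical
  obtain ⟨α, hα⟩ := ne_zero_iff.mp h0
  have h1 : coeff e (p * p) = ε * ∑ x ∈ Finset.HasAntidiagonal.antidiagonal e, coeff x.1 p ^ 2 := by
    rw [coeff_mul, Finset.mul_sum]
    refine Finset.sum_congr rfl fun x hx => ?_
    rw [hp.coeff_eq x.2 x.1 ((add_comm _ _).trans (Finset.HasAntidiagonal.mem_antidiagonal.mp hx))]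
    ring
  rw [h1]
  refine mul_ne_zero hε (Finset.sum_pos' (fun _ _ => sq_nonneg _) ⟨(α, e - α), ?_, ?_⟩).ne'
  · exact Finset.HasAntidiagonal.mem_antidiagonal.mpr (add_tsub_cancel_of_le (hp.le _ hα))
  · exact sq_pos_of_ne_zero hα

end Palindromic

/-! ### Powers of the Vandermonde product -/

/-- The Vandermonde product in three variables. -/
noncomputable def vandermonde (k : Type*) [CommRing k] : MvPolynomial (Fin 3) k :=
  (X 0 - X 1) * (X 1 - X 2) * (X 2 - X 0)

theorem isPalindromic_vandermonde_pow (a : ℕ) : IsPalindromic (vandermonde ℤ ^ a)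
    (Finsupp.equivFunOnFinite.symm fun _ => 2 * a) ((-1) ^ a) := by
  have h := ((((IsPalindromic.X_sub_X (k := ℤ) (0 : Fin 3) 1).mul
    (IsPalindromic.X_sub_X 1 2)).mul (IsPalindromic.X_sub_X 2 0)).pow a)
  have he : (Finsupp.equivFunOnFinite.symm fun _ => 2 * a : Fin 3 →₀ ℕ) =
      a • (Finsupp.single 0 1 + Finsupp.single 1 1 + (Finsupp.single 1 1 + Finsupp.single 2 1) +
        (Finsupp.single 2 1 + Finsupp.single 0 1)) := by
    ext i
    fin_cases i <;> simp [two_mul]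
  rw [he]
  simpa [vandermonde] using h

theorem vandermonde_ne_zero : vandermonde ℤ ≠ 0 := by
  intro h
  have := congrArg (eval ![0, 1, 2]) h
  simp [vandermonde] at this

theorem coeff_vandermonde_pow_ne_zero (a : ℕ) :
    coeff (Finsupp.equivFunOnFinite.symm fun _ => 2 * a) (vandermonde ℤ ^ (2 * a)) ≠ 0 := by
  rw [two_mul a, pow_add, ← two_mul]
  exact (isPalindromic_vandermonde_pow a).coeff_mul_self_ne_zero
    (pow_ne_zero _ vandermonde_ne_zero) (pow_ne_zero _ (by norm_num))

theorem map_vandermonde (k : Type*) [CommRing k] :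
    map (Int.castRingHom k) (vandermonde ℤ) = vandermonde k := by
  simp [vandermonde]

theorem isHomogeneous_vandermonde (k : Type*) [CommRing k] : (vandermonde k).IsHomogeneous 3 :=
  (((isHomogeneous_X k _).sub (isHomogeneous_X k _)).mul
    ((isHomogeneous_X k _).sub (isHomogeneous_X k _))).mul
    ((isHomogeneous_X k _).sub (isHomogeneous_X k _))

/-- The infinitesimal generator of simultaneous translation of the three variables. -/
noncomputable def translation (k : Type*) [CommRing k] :
    Derivation k (MvPolynomial (Fin 3) k) (MvPolynomial (Fin 3) k) :=
  mkDerivation k fun _ => 1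

theorem translation_vandermonde (k : Type*) [CommRing k] :
    translation k (vandermonde k) = 0 := by
  simp [translation, vandermonde, Derivation.leibniz]

theorem translation_vandermonde_pow (k : Type*) [CommRing k] (a : ℕ) :
    translation k (vandermonde k ^ a) = 0 := by
  rw [Derivation.leibniz_pow, translation_vandermonde, smul_zero, smul_zero]

/-! ### Cubic invariants by the symbolic method -/

section Umbral

variable (k : Type*) [Field k] (n : ℕ)

/-- The variables of `R k n`, scaled so that the Weitzenböck derivation acts like `d/du` on
powers of `u`. -/
noncomputable def scaledVar (j : ℕ) : R k n := C (j.factorial : k) * var k n j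

variable {n} in
theorem weitzenboeck_scaledVar {j : ℕ} (h : j ≤ n) :
    weitzenboeck k n (scaledVar k n j) = C (j : k) * scaledVar k n (j - 1) := by
  rw [scaledVar, derivation_C_mul_apply]
  rcases j with _ | j
  · simp [weitzenboeck_var_zero]
  · rw [weitzenboeck_var_succ k h, scaledVar, Nat.factorial_succ, Nat.cast_mul, C_mul, mul_assoc]
    rfl

/-- The umbral map `u ^ a v ^ b w ^ c ↦ a! b! c! x_a x_b x_c`. -/
noncomputable def umbral : MvPolynomial (Fin 3) k →ₗ[k] R k n :=
  (basisMonomials (Fin 3) k).constr k fun α => ∏ i, scaledVar k n (α i)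

theorem umbral_monomial (α : Fin 3 →₀ ℕ) (c : k) :
    umbral k n (monomial α c) = C c * ∏ i, scaledVar k n (α i) := by
  have h : (monomial α c : MvPolynomial (Fin 3) k) = c • basisMonomials (Fin 3) k α := by
    rw [coe_basisMonomials, smul_monomial, smul_eq_mul, mul_one]
  rw [h, map_smul, umbral, Module.Basis.constr_basis, smul_eq_C_mul]

/-- On scaled variables the derivation imitates `d/du`. The exponent bound matters: `x_{n+1}` is
read as `0`, while `d/du` would lead from it to `x_n`. -/
theorem weitzenboeck_umbral {p : MvPolynomial (Fin 3) k}
    (hp : ∀ α, coeff α p ≠ 0 → ∀ i, α i ≤ n) :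
    weitzenboeck k n (umbral k n p) = umbral k n (translation k p) := by
  rw [p.as_sum, map_sum, map_sum, map_sum, map_sum]
  refine Finset.sum_congr rfl fun α hα => ?_
  have hle := hp α (mem_support_iff.mp hα)
  rw [translation, mkDerivation_monomial, Finsupp.sum_fintype _ _ (by simp)]
  rw [map_smul, umbral_monomial, derivation_C_mul_apply, smul_eq_C_mul]
  simp only [smul_eq_mul, mul_one, Fin.sum_univ_three, map_add, umbral_monomial,
    Fin.prod_univ_three, Derivation.leibniz, weitzenboeck_scaledVar k (hle _)]
  refine congrArg (C (coeff α p) * ·) ?_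
  simp
  ring

theorem umbral_mem_A {p : MvPolynomial (Fin 3) k} (hp : ∀ α, coeff α p ≠ 0 → ∀ i, α i ≤ n)
    (h : translation k p = 0) : umbral k n p ∈ A k n := by
  change weitzenboeck k n _ = 0
  rw [weitzenboeck_umbral k n hp, h, map_zero]

theorem π_var (m j : ℕ) (h : j ≤ m) : π k m (2 * m) (var k (2 * m) j) =
    if j = m then X 0 else 0 := by
  rw [var_of_le (by omega), π, aeval_X]
  rcases h.eq_or_lt with rfl | h
  · rw [if_neg (by simp; omega), if_pos rfl]
    congr 1
    ext
    simp
    omega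
  · rw [if_pos (by simp; omega), if_neg h.ne]

/-- Three exponents with sum `3m`, not all equal to `m`, include one below `m`, and `π` kills that
variable. -/
theorem π_umbral {m : ℕ} {p : MvPolynomial (Fin 3) k} (hp : p.IsHomogeneous (3 * m)) :
    π k m (2 * m) (umbral k (2 * m) p) =
      C (coeff (Finsupp.equivFunOnFinite.symm fun _ => m) p * (m.factorial : k) ^ 3) * X 0 ^ 3 := by
  conv_lhs => rw [p.as_sum]
  rw [map_sum, map_sum, Finset.sum_eq_single (Finsupp.equivFunOnFinite.symm fun _ => m)]
  · have h : π k m (2 * m) (scaledVar k (2 * m) m) = C (m.factorial : k) * X 0 := by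
      rw [scaledVar, map_mul, π_var k m m le_rfl, if_pos rfl, ← algebraMap_eq, AlgHom.commutes]
      rfl
    rw [umbral_monomial, map_mul, ← algebraMap_eq, AlgHom.commutes]
    simp only [Finsupp.equivFunOnFinite_symm_apply_apply, Finset.prod_const, Finset.card_univ,
      Fintype.card_fin, map_pow, h, algebraMap_eq, map_mul]
    ring
  · intro α hα hne
    have hd : α 0 + α 1 + α 2 = 3 * m := by
      have := hp (mem_support_iff.mp hα)
      rwa [Pi.one_def, ← Finsupp.degree_eq_weight_one, Finsupp.degree_eq_sum,
        Fin.sum_univ_three] at this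
    obtain ⟨i, hi⟩ : ∃ i, α i < m := by
      by_contra! h
      refine hne (Finsupp.ext fun i => ?_)
      have := h 0
      have := h 1
      have := h 2
      fin_cases i <;> simp <;> omega
    rw [umbral_monomial, map_mul, map_prod, Finset.prod_eq_zero (Finset.mem_univ i), mul_zero]
    rw [scaledVar, map_mul, π_var k m _ hi.le, if_neg hi.ne, mul_zero]
  · intro h
    rw [notMem_support_iff.mp h, monomial_zero, map_zero, map_zero]

end Umbral

/-! ### The images in parts (c) and (d) -/

section

variable {k : Type*} [Field k]

theorem X_sq_mem_map_π (m : ℕ) : (X 0 ^ 2 : R k m) ∈ (A k (2 * m)).map (π k m (2 * m)) := by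
  have hmem := alternatingQuadric_mem k (le_refl (2 * m))
  have hπ : π k m (2 * m) (alternatingQuadric k (2 * m) (2 * m)) = C ((-1) ^ m) * X 0 ^ 2 := by
    rw [alternatingQuadric, map_sum, Finset.sum_eq_single m]
    · rw [map_mul, map_mul, show 2 * m - m = m by omega, π_var k m m le_rfl, if_pos rfl,
        ← algebraMap_eq, AlgHom.commutes, pow_two]
      rfl
    · intro j hj hne
      rw [Finset.mem_range] at hj
      rw [map_mul, map_mul]
      rcases lt_or_gt_of_ne hne with h | h
      · rw [π_var k m j h.le, if_neg hne, zero_mul, mul_zero]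
      · rw [π_var k m (2 * m - j) (by omega), if_neg (by omega), mul_zero, mul_zero]
    · intro h
      exact absurd (Finset.mem_range.mpr (by omega)) h
  have h := Subalgebra.smul_mem _ (Subalgebra.mem_map.mpr ⟨_, hmem, hπ⟩) ((-1 : k) ^ m)
  rwa [smul_eq_C_mul, ← mul_assoc, ← C_mul, ← mul_pow, neg_one_mul, neg_neg, one_pow, C_1,
    one_mul] at h

variable [CharZero k]

theorem X_pow_three_mem_map_π {m : ℕ} (hm : Even m) :
    (X 0 ^ 3 : R k m) ∈ (A k (2 * m)).map (π k m (2 * m)) := by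
  obtain ⟨a, rfl⟩ := hm.two_dvd
  have hpal := isPalindromic_vandermonde_pow (2 * a)
  have hmap : vandermonde k ^ (2 * a) = map (Int.castRingHom k) (vandermonde ℤ ^ (2 * a)) := by
    rw [map_pow, map_vandermonde]
  have hmem := umbral_mem_A k (2 * (2 * a)) (p := vandermonde k ^ (2 * a)) (fun α hα i => by
    rw [hmap, coeff_map] at hα
    exact hpal.le α (fun h => hα (by rw [h, map_zero])) i) (translation_vandermonde_pow k _)
  have hπ := π_umbral k (m := 2 * a) (p := vandermonde k ^ (2 * a))
    ((isHomogeneous_vandermonde k).pow _)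
  rw [hmap, coeff_map, ← hmap] at hπ
  set c : k := Int.castRingHom k (coeff (Finsupp.equivFunOnFinite.symm fun _ => 2 * a)
    (vandermonde ℤ ^ (2 * a))) * ((2 * a).factorial : k) ^ 3
  -- Nonvanishing is proved over `ℤ`, where sums of squares are positive, and transferred to `k` by
  -- characteristic zero.
  have hc : c ≠ 0 := mul_ne_zero (Int.cast_ne_zero.mpr (coeff_vandermonde_pow_ne_zero a))
    (pow_ne_zero _ (Nat.cast_ne_zero.mpr (Nat.factorial_ne_zero _)))
  have h := Subalgebra.smul_mem _ (Subalgebra.mem_map.mpr ⟨_, hmem, hπ⟩) c⁻¹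
  rwa [smul_eq_C_mul, ← mul_assoc (C c⁻¹), ← C_mul, inv_mul_cancel₀ hc, C_1, one_mul] at h

theorem π_mem_of_coeff_middle {m : ℕ} {f : R k (2 * m)} (hf : f ∈ A k (2 * m))
    (B : Subalgebra k (R k m))
    (h : ∀ d, coeff (Finsupp.single ⟨m, by omega⟩ d) f ≠ 0 → X 0 ^ d ∈ B) :
    π k m (2 * m) f ∈ B := by
  refine π_mem_of_monomials B fun α hα hi => ?_
  have hα := mem_support_iff.mp hα
  have hs : α = Finsupp.single ⟨m, by omega⟩ (α ⟨m, by omega⟩) := by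
    refine eq_single_of_forall_ne_zero fun i hi' => Fin.ext ?_
    have := two_mul_eq_of_sum_nonneg (weight_nonneg_of_coeff_ne_zero hf hα)
      (fun j hj => by have := hi j hj; omega) hi'
    simp
    omega
  rw [hs] at hα ⊢
  have h1 := h _ hα
  have h2 (d : ℕ) (c : k) : (monomial (Finsupp.single ⟨m, by omega⟩ d) c : R k (2 * m)) =
      C c * var k _ m ^ d := by
    rw [var_of_le (by omega), C_mul_X_pow_eq_monomial]
  rw [h2, map_mul, map_pow, π_var k m m le_rfl, if_pos rfl, ← algebraMap_eq, AlgHom.commutes,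
    ← Algebra.smul_def]
  exact Subalgebra.smul_mem _ h1 _

theorem map_π_of_odd {m : ℕ} (hm : Odd m) : (A k (2 * m)).map (π k m (2 * m)) =
    Algebra.adjoin k {(X 0 : R k m) ^ 2} := by
  refine le_antisymm ?_ (Algebra.adjoin_le ?_)
  · rintro _ ⟨f, hf, rfl⟩
    refine π_mem_of_coeff_middle hf _ fun d hd => ?_
    rcases Nat.even_or_odd d with h | h
    · obtain ⟨e, rfl⟩ := h.two_dvd
      rw [pow_mul]
      exact Subalgebra.pow_mem _ (Algebra.subset_adjoin (Set.mem_singleton _)) e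
    · exact absurd (coeff_middle_eq_zero_of_odd hm h hf) hd
  · rintro _ rfl
    exact X_sq_mem_map_π m

theorem map_π_of_even {m : ℕ} (h1 : 1 ≤ m) (hm : Even m) :
    (A k (2 * m)).map (π k m (2 * m)) =
      Algebra.adjoin k {(X 0 : R k m) ^ 2, (X 0 : R k m) ^ 3} := by
  refine le_antisymm ?_ (Algebra.adjoin_le ?_)
  · rintro _ ⟨f, hf, rfl⟩
    refine π_mem_of_coeff_middle hf _ fun d hd => ?_
    have h2 : (X 0 : R k m) ^ 2 ∈ Algebra.adjoin k {(X 0 : R k m) ^ 2, (X 0 : R k m) ^ 3} :=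
      Algebra.subset_adjoin (Or.inl rfl)
    have h3 : (X 0 : R k m) ^ 3 ∈ Algebra.adjoin k {(X 0 : R k m) ^ 2, (X 0 : R k m) ^ 3} :=
      Algebra.subset_adjoin (Or.inr rfl)
    have hd1 : d ≠ 1 := by
      rintro rfl
      exact hd (coeff_middle_one_eq_zero h1 hf)
    -- Every exponent other than `1` lies in the semigroup generated by `2` and `3`.
    rcases Nat.even_or_odd' d with ⟨e, rfl | rfl⟩
    · rw [pow_mul]
      exact Subalgebra.pow_mem _ h2 e
    · obtain ⟨l, rfl⟩ : ∃ l, e = l + 1 := ⟨e - 1, by omega⟩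
      rw [show 2 * (l + 1) + 1 = 2 * l + 3 by ring, pow_add, pow_mul]
      exact Subalgebra.mul_mem _ (Subalgebra.pow_mem _ h2 l) h3
  · rintro _ (rfl | rfl)
    · exact X_sq_mem_map_π m
    · exact X_pow_three_mem_map_π hm

end

end BasicGa

theorem proposition3p1 (k : Type*) [Field k] [CharZero k] :
    (∀ n : ℕ, (BasicGa.hilbertIdeal k n).radical =
      Ideal.span ((fun i : Fin (n + 1) => (MvPolynomial.X i : BasicGa.R k n)) ''
        {i | (i : ℕ) ≤ n / 2})) ∧
    (∀ n : ℕ, 1 ≤ n →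
      (BasicGa.A k n).map (BasicGa.π k (n - n / 2 - 1) n) = ⊥) ∧
    (∀ m : ℕ, Odd m →
      (BasicGa.A k (2 * m)).map (BasicGa.π k m (2 * m)) =
        Algebra.adjoin k {(MvPolynomial.X 0 : BasicGa.R k m) ^ 2}) ∧
    (∀ m : ℕ, 1 ≤ m → Even m →
      (BasicGa.A k (2 * m)).map (BasicGa.π k m (2 * m)) =
        Algebra.adjoin k
          {(MvPolynomial.X 0 : BasicGa.R k m) ^ 2, (MvPolynomial.X 0 : BasicGa.R k m) ^ 3}) :=
  ⟨fun _ => BasicGa.radical_hilbertIdeal, fun _ hn => BasicGa.map_π_eq_bot hn,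
    fun _ hm => BasicGa.map_π_of_odd hm, fun _ h1 hm => BasicGa.map_π_of_even h1 hm⟩
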